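/- Let $\nu$ be a non-zero measure on $(0,\infty)$ with $\int_0^\infty \min(1,z)\,\nu(dz)<\infty$, let $M$ be a Poisson random measure on $[0,\infty)\times(0,\infty)$ with intensity $dt\otimes\nu(dz)$, and let $$X_t=\int_{(0,\infty)} z\,M([0,t],dz),\qquad X^{(\epsilon)}_t=\int_{[\epsilon,\infty)}\epsilon\lfloor z/\epsilon\rfloor\,M([0,t],dz),\qquad t\ge 0,\ \epsilon\in(0,1)\cap\mathbb{Q},$$ be the driftless pure-jump subordinator with Lévy measure $\nu$ and its lattice discretisation. Define $I_{[Y]}=\int_0^\infty e^{-Y_t}\,dt\in[0,\infty]$ and $$\varrho(\epsilon)=\Big(\int_0^\epsilon\nu([z,\infty))\,dz\Big)^{1/2},\qquad \Psi^{(1)}(u)=\sum_{k\ge1}(1-e^{-uk})\,\nu([k,k+1)).$$ Then $I_{[X]}$ and all $I_{[X^{(\epsilon)}]}$ are random variables, $\mathsf{E}\,I_{[X]}<\infty$, and $$\mathsf{E}\big|I_{[X]}-I_{[X^{(\epsilon)}]}\big|\to0\qquad\text{as }\epsilon\searrow0,\ \epsilon\in(0,1)\cap\mathbb{Q}.$$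 More precisely: (a) If $\nu([1,\infty))>0$, then for every $\epsilon\in(0,1)\cap\mathbb{Q}$ $$\mathsf{E}\big|I_{[X]}-I_{[X^{(\epsilon)}]}\big|\le (C_1+C_2)\,\varrho^2(\epsilon),$$ where $$C_1=\int_0^\infty te^{-t\Psi^{(1)}(1)}\,dt=\frac{1}{(\Psi^{(1)}(1))^2}\in(0,\infty),\qquad C_2=\int_0^\infty\sqrt{t}\,e^{-t\Psi^{(1)}(2)/2}\,dt=\frac{\sqrt{2\pi}}{(\Psi^{(1)}(2))^{3/2}}\in(0,\infty).$$ (b) In general, for every $\delta\in(0,1]$ with $\nu([\delta,\infty))>0$ there is a constant $C\in(0,\infty)$, depending only on $\nu$ and $\delta$, such that $\mathsf{E}|I_{[X]}-I_{[X^{(\epsilon)}]}|\le C\,\varrho^2(\epsilon)$ for every $\epsilon\in(0,\delta)\cap\mathbb{Q}$. -/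

import Mathlib

open MeasureTheory ProbabilityTheory Filter Topology
open scoped ENNReal NNReal

noncomputable section

/-- `ν` is the Lévy measure of a subordinator: it is carried by `(0, ∞)` and
`∫ min(1, z) ν(dz) < ∞`. -/
structure IsSubordinatorLevyMeasure (ν : Measure ℝ) : Prop where
  measure_Iic : ν (Set.Iic 0) = 0
  lintegral_min_lt_top : ∫⁻ z, ENNReal.ofReal (min 1 z) ∂ν < ∞

/-- The Poisson distribution with mean `r ∈ [0, ∞]`, as a measure on `[0, ∞]`;
for `r = ∞` it is the unit mass at `∞`. -/
def extendedPoissonLaw (r : ℝ≥0∞) : Measure ℝ≥0∞ :=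
  if r = ∞ then Measure.dirac ∞
  else (poissonMeasure r.toNNReal).map (fun n : ℕ => (n : ℝ≥0∞))

/-- `M` is a Poisson random measure on `E` with intensity measure `μ`, defined on the probability
space `(Ω, P)`: the masses of measurable sets are Poisson random variables with means given by `μ`,
and the masses of finitely many pairwise disjoint measurable sets are independent. -/
structure IsPoissonRandomMeasure {Ω E : Type*} [MeasurableSpace Ω] [MeasurableSpace E]
    (M : Ω → Measure E) (μ : Measure E) (P : Measure Ω) : Prop where
  measurable_apply : ∀ B : Set E, MeasurableSet B → Measurable (fun ω => M ω B)
  map_apply : ∀ B : Set E, MeasurableSet B → P.map (fun ω => M ω B) = extendedPoissonLaw (μ B)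
  indep : ∀ (n : ℕ) (B : Fin n → Set E), (∀ i, MeasurableSet (B i)) →
    (Pairwise fun i j => Disjoint (B i) (B j)) → iIndepFun (fun i ω => M ω (B i)) P

/-- The measure `dt ⊗ ν(dz)` on `[0, ∞) × (0, ∞)`, as a measure on `ℝ × ℝ`. -/
def jumpIntensity (ν : Measure ℝ) : Measure (ℝ × ℝ) :=
  (volume.restrict (Set.Ici 0)).prod ν

/-- The pure-jump subordinator `X_t = ∫_{(0, ∞)} z M([0, t], dz)`. -/
def pureJumpSubordinator {Ω : Type*} (M : Ω → Measure (ℝ × ℝ)) (t : ℝ) (ω : Ω) : ℝ≥0∞ :=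
  ∫⁻ p in Set.Icc 0 t ×ˢ Set.Ioi 0, ENNReal.ofReal p.2 ∂(M ω)

/-- The lattice discretisation `X^{(ε)}_t = ∫_{[ε, ∞)} ε ⌊z / ε⌋ M([0, t], dz)`. -/
def latticeSubordinator {Ω : Type*} (M : Ω → Measure (ℝ × ℝ)) (ε : ℝ) (t : ℝ) (ω : Ω) : ℝ≥0∞ :=
  ∫⁻ p in Set.Icc 0 t ×ˢ Set.Ici ε, ENNReal.ofReal (ε * (⌊p.2 / ε⌋ : ℝ)) ∂(M ω)

/-- The exponential functional `I_{[Y]} = ∫_0^∞ exp(-Y_t) dt`, with values in `[0, ∞]`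
(and `exp(-∞) = 0`). -/
def expFunctional {Ω : Type*} (Y : ℝ → Ω → ℝ≥0∞) (ω : Ω) : ℝ≥0∞ :=
  ∫⁻ t in Set.Ioi (0 : ℝ), EReal.exp (-(Y t ω : EReal))

/-- The `L¹` distance `E|U - V|` of two `[0, ∞]`-valued random variables; the integrand is `|U - V|`
because subtraction in `[0, ∞]` is truncated at zero. -/
def l1Distance {Ω : Type*} [MeasurableSpace Ω] (P : Measure Ω) (U V : Ω → ℝ≥0∞) : ℝ≥0∞ :=
  ∫⁻ ω, ((U ω - V ω) + (V ω - U ω)) ∂P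

/-- The Laplace exponent `u ↦ ∫_{(0, ∞)} (1 - exp(-u z)) ν(dz)` of the driftless subordinator with
Lévy measure `ν`. -/
def laplaceExponent (ν : Measure ℝ) (u : ℝ) : ℝ :=
  ∫ z in Set.Ioi 0, (1 - Real.exp (-(u * z))) ∂ν

/-- The Lévy measure `∑_{k ≥ 1} ν([ε k, ε (k + 1))) δ_{ε k}` of the lattice discretisation
(the index below is `k - 1`). -/
def latticeLevyMeasure (ν : Measure ℝ) (ε : ℝ) : Measure ℝ :=
  Measure.sum fun j : ℕ =>
    ν (Set.Ico (ε * ((j : ℝ) + 1)) (ε * ((j : ℝ) + 2))) • Measure.dirac (ε * ((j : ℝ) + 1))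

/-- The Laplace exponent `Ψ^{(ε)}` of the lattice discretisation. -/
def latticeLaplaceExponent (ν : Measure ℝ) (ε u : ℝ) : ℝ :=
  laplaceExponent (latticeLevyMeasure ν ε) u

/-- `ϱ(ε) = (∫_0^ε ν([z, ∞)) dz)^{1/2}`. -/
def rateRho (ν : Measure ℝ) (ε : ℝ) : ℝ :=
  Real.sqrt (∫ z in Set.Ioc 0 ε, (ν (Set.Ici z)).toReal)

/-- `C₁ = ∫_0^∞ t exp(-t Ψ^{(1)}(1)) dt`. -/
def constOne (ν : Measure ℝ) : ℝ :=
  ∫ t in Set.Ioi 0, t * Real.exp (-(t * latticeLaplaceExponent ν 1 1))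

/-- `C₂ = ∫_0^∞ √t exp(-t Ψ^{(1)}(2) / 2) dt`. -/
def constTwo (ν : Measure ℝ) : ℝ :=
  ∫ t in Set.Ioi 0, Real.sqrt t * Real.exp (-(t * latticeLaplaceExponent ν 1 2 / 2))

end

/-! Discarding jumps below `ε` and rounding the others down gives X^(ε) ≤ X on every path, hence
I_[X] ≤ I_[X^(ε)]. The L¹ distance is therefore a difference of two means (`l1Distance_eq`), and no
second-moment or coupling estimate is needed.

The means are explicit. The Laplace functional of a Poisson random measure gives E exp(-Y_t) =
exp(-tΦ(1)) for a subordinator Y with Laplace exponent Φ, and Tonelli turns this into E I_[Y] =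
1/Φ(1) (`lintegral_expFunctional`). This leaves a bound on 1/φ - 1/(s + Ψ). Here φ is the exponent
of X^(ε) at 1, and s and Ψ are the contributions of jumps below and above `ε` to the exponent of X
at 1. By Tonelli, ϱ²(ε) = ∫ min(z, ε) ν(dz) = r + b with r = ∫_{z<ε} z ν(dz) and b = ε ν([ε, ∞)).
Clearly s ≤ r, and rounding moves each jump by at most `ε`, so Ψ - φ ≤ b.

A lower bound for φ that is uniform in `ε` now gives (b). The explicit constant in (a) is subtler,
because a = Ψ^(1)(1) may exceed φ: a jump of size 1 can be rounded below 1 on the `ε`-lattice. The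
excess is itself of order b, and sharp pointwise inequalities (`one_sub_exp_neg_floor_le`) fed into
`one_div_sub_one_div_le` absorb it. This yields the bound ϱ²(ε)/a² = C₁ϱ²(ε), so C₂ enters (a) only
through being positive. -/

/-! ### The exponential on [0, ∞] and the Poisson Laplace transform. -/

/-- The function `y ↦ exp(-y)` on `[0, ∞]`. -/
noncomputable def expNeg (y : ℝ≥0∞) : ℝ≥0∞ := EReal.exp (-(y : EReal))

lemma expNeg_zero : expNeg 0 = 1 := by simp [expNeg]

lemma expNeg_add (a b : ℝ≥0∞) : expNeg (a + b) = expNeg a * expNeg b := by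
  rw [expNeg, EReal.coe_ennreal_add, EReal.neg_add (.inl (EReal.coe_ennreal_ne_bot _))
    (.inr (EReal.coe_ennreal_ne_bot _)), sub_eq_add_neg, EReal.exp_add, expNeg, expNeg]

lemma expNeg_sum {ι : Type*} (s : Finset ι) (f : ι → ℝ≥0∞) :
    expNeg (∑ i ∈ s, f i) = ∏ i ∈ s, expNeg (f i) := by
  classical
  induction s using Finset.induction_on with
  | empty => simp [expNeg_zero]
  | insert a s ha ih => rw [Finset.sum_insert ha, Finset.prod_insert ha, expNeg_add, ih]

lemma expNeg_ofReal {x : ℝ} (hx : 0 ≤ x) :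
    expNeg (ENNReal.ofReal x) = ENNReal.ofReal (Real.exp (-x)) := by
  rw [expNeg, EReal.coe_ennreal_ofReal, max_eq_left hx, ← EReal.coe_neg, EReal.exp_coe]

lemma expNeg_antitone : Antitone expNeg := fun _ _ h =>
  EReal.exp_monotone (EReal.neg_le_neg_iff.2 (EReal.coe_ennreal_le_coe_ennreal_iff.2 h))

lemma expNeg_le_one (y : ℝ≥0∞) : expNeg y ≤ 1 :=
  (expNeg_antitone (zero_le (a := y))).trans_eq expNeg_zero

lemma expNeg_lt_one {y : ℝ≥0∞} (hy : y ≠ 0) : expNeg y < 1 := by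
  rw [expNeg, EReal.exp_lt_one_iff, EReal.neg_lt_comm, neg_zero, EReal.coe_ennreal_pos]
  exact pos_iff_ne_zero.2 hy

lemma continuous_expNeg : Continuous expNeg :=
  ENNReal.continuous_exp.comp (continuous_neg.comp continuous_coe_ennreal_ereal)

lemma measurable_expNeg : Measurable expNeg := continuous_expNeg.measurable

/-- This is the Poisson generating function E q^N = exp(-(1 - q)r) at q = exp(-x). For r = ∞ both
sides are 1 or 0 according as x = 0 or not, by the convention 0 · ∞ = 0. -/
lemma lintegral_expNeg_extendedPoissonLaw {x : ℝ≥0∞} (hx : x ≠ ∞) (r : ℝ≥0∞) :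
    ∫⁻ y, expNeg (x * y) ∂(extendedPoissonLaw r) = expNeg ((1 - expNeg x) * r) := by
  have hmeas : Measurable fun y => expNeg (x * y) :=
    measurable_expNeg.comp (measurable_const_mul x)
  by_cases hr : r = ∞
  · subst hr
    rw [extendedPoissonLaw, if_pos rfl, lintegral_dirac' _ hmeas]
    by_cases h0 : x = 0
    · simp [h0, expNeg_zero]
    · rw [ENNReal.mul_top h0, ENNReal.mul_top (tsub_pos_of_lt (expNeg_lt_one h0)).ne']
  · lift r to ℝ≥0 using hr
    lift x to ℝ≥0 using hx
    rw [extendedPoissonLaw, if_neg ENNReal.coe_ne_top, lintegral_map hmeas .of_discrete,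
      ENNReal.toNNReal_coe, poissonMeasure, lintegral_sum_measure]
    set q : ℝ := Real.exp (-x) with hq
    have hq0 : 0 < q := Real.exp_pos _
    have hq1 : q ≤ 1 := Real.exp_le_one_iff.2 (by simp)
    have hex : expNeg (x : ℝ≥0∞) = ENNReal.ofReal q := by
      rw [← ENNReal.ofReal_coe_nnreal, expNeg_ofReal x.coe_nonneg]
    have hterm : ∀ n : ℕ, ∫⁻ a : ℕ, expNeg ((x : ℝ≥0∞) * (a : ℝ≥0∞))
        ∂(ENNReal.ofReal (Real.exp (-r) * r ^ n / n.factorial) • Measure.dirac n) =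
        ENNReal.ofReal (Real.exp (-r) * ((r * q) ^ n / n.factorial)) := by
      intro n
      rw [lintegral_smul_measure, lintegral_dirac]
      have : expNeg ((x : ℝ≥0∞) * (n : ℝ≥0∞)) = ENNReal.ofReal (q ^ n) := by
        rw [← ENNReal.ofReal_coe_nnreal, ← ENNReal.ofReal_natCast, ← ENNReal.ofReal_mul x.coe_nonneg,
          expNeg_ofReal (by positivity), hq, ← Real.exp_nat_mul]
        congr 2; ring
      rw [this, smul_eq_mul, ← ENNReal.ofReal_mul (by positivity)]
      congr 1
      rw [mul_pow]; ring
    have hsum : HasSum (fun n : ℕ => Real.exp (-r) * ((r * q) ^ n / n.factorial))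
        (Real.exp (-r) * Real.exp (r * q)) := by
      rw [Real.exp_eq_exp_ℝ]
      exact (NormedSpace.expSeries_div_hasSum_exp ((r : ℝ) * q)).mul_left _
    simp_rw [hterm]
    rw [← ENNReal.ofReal_tsum_of_nonneg (fun n => by positivity) hsum.summable, hsum.tsum_eq, hex,
      ← ENNReal.ofReal_one, ← ENNReal.ofReal_sub _ hq0.le, ← ENNReal.ofReal_coe_nnreal (p := r),
      ← ENNReal.ofReal_mul (by linarith), expNeg_ofReal (mul_nonneg (by linarith) r.coe_nonneg),
      ← Real.exp_add]
    congr 2; ring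

/-! ### The Laplace functional of a Poisson random measure. -/

namespace IsPoissonRandomMeasure

variable {Ω E : Type*} [MeasurableSpace Ω] [MeasurableSpace E] {M : Ω → Measure E}
  {μ : Measure E} {P : Measure Ω}

lemma measurable (hM : IsPoissonRandomMeasure M μ P) : Measurable M :=
  Measure.measurable_of_measurable_coe M hM.measurable_apply

lemma lintegral_expNeg_mul_apply (hM : IsPoissonRandomMeasure M μ P) {x : ℝ≥0∞} (hx : x ≠ ∞)
    {B : Set E} (hB : MeasurableSet B) :
    ∫⁻ ω, expNeg (x * M ω B) ∂P = expNeg ((1 - expNeg x) * μ B) := by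
  rw [← lintegral_expNeg_extendedPoissonLaw hx, ← hM.map_apply B hB,
    lintegral_map (f := fun y => expNeg (x * y))
      (measurable_expNeg.comp (measurable_const_mul x)) (hM.measurable_apply B hB)]

/-- The fibres of a simple function are disjoint, so independence factors the expectation into
one-dimensional Poisson transforms. -/
lemma lintegral_expNeg_simpleFunc (hM : IsPoissonRandomMeasure M μ P) (s : SimpleFunc E ℝ≥0∞)
    (hs : ∀ p, s p ≠ ∞) :
    ∫⁻ ω, expNeg (∫⁻ p, s p ∂(M ω)) ∂P = expNeg (∫⁻ p, (1 - expNeg (s p)) ∂μ) := by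
  let σ := s.range.equivFin.symm
  let B : Fin s.range.card → Set E := fun i => s ⁻¹' {(σ i : ℝ≥0∞)}
  have hB : ∀ i, MeasurableSet (B i) := fun i => s.measurableSet_fiber _
  have hdisj : Pairwise fun i j => Disjoint (B i) (B j) := fun i j hij =>
    Disjoint.preimage _ (Set.disjoint_singleton.2 fun h => hij (σ.injective (Subtype.ext h)))
  have hσ : ∀ i, (σ i : ℝ≥0∞) ≠ ∞ := fun i => by
    obtain ⟨p, hp⟩ := SimpleFunc.mem_range.1 (σ i).2
    exact hp ▸ hs p
  have hreindex : ∀ f : ℝ≥0∞ → ℝ≥0∞, ∑ x ∈ s.range, f x = ∑ i, f (σ i) := fun f => by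
    rw [← Finset.sum_coe_sort, ← Equiv.sum_comp σ]
  have hind : iIndepFun (fun i ω => expNeg ((σ i : ℝ≥0∞) * M ω (B i))) P :=
    (hM.indep _ B hB hdisj).comp (fun i y => expNeg ((σ i : ℝ≥0∞) * y))
      fun i => measurable_expNeg.comp (measurable_const_mul _)
  have hleft : ∀ ω, expNeg (∫⁻ p, s p ∂(M ω)) = ∏ i, expNeg ((σ i : ℝ≥0∞) * M ω (B i)) := by
    intro ω
    rw [SimpleFunc.lintegral_eq_lintegral, SimpleFunc.lintegral,
      hreindex fun x => x * M ω (s ⁻¹' {x}), expNeg_sum]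
  have hright : ∫⁻ p, (1 - expNeg (s p)) ∂μ = ∑ i, (1 - expNeg (σ i)) * μ (B i) := by
    have := SimpleFunc.map_lintegral (μ := μ) (fun x => 1 - expNeg x) s
    rw [← SimpleFunc.lintegral_eq_lintegral,
      hreindex fun x => (1 - expNeg x) * μ (s ⁻¹' {x})] at this
    exact this
  simp_rw [hleft]
  rw [lintegral_prod_eq_prod_lintegral_of_indepFun _ _ hind fun i =>
    measurable_expNeg.comp ((hM.measurable_apply _ (hB i)).const_mul _), hright, expNeg_sum]
  exact Finset.prod_congr rfl fun i _ => hM.lintegral_expNeg_mul_apply (hσ i) (hB i)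

/-- The Laplace functional of a Poisson random measure. -/
theorem lintegral_expNeg_lintegral [IsProbabilityMeasure P] (hM : IsPoissonRandomMeasure M μ P)
    {h : E → ℝ≥0∞} (hh : Measurable h) :
    ∫⁻ ω, expNeg (∫⁻ p, h p ∂(M ω)) ∂P = expNeg (∫⁻ p, (1 - expNeg (h p)) ∂μ) := by
  -- Finite-valued simple functions increasing to `h`. Integrals against `M ω` and `μ` converge
  -- monotonically; the expectation over `ω` is dominated by 1.
  let s := SimpleFunc.eapprox h
  have hmono : ∀ p, Monotone fun n => s n p := fun p _ _ hnm =>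
    SimpleFunc.monotone_eapprox h hnm p
  have hlim : ∀ p, Tendsto (fun n => s n p) atTop (𝓝 (h p)) :=
    SimpleFunc.tendsto_eapprox hh
  have h1 : Tendsto (fun n => ∫⁻ ω, expNeg (∫⁻ p, s n p ∂(M ω)) ∂P) atTop
      (𝓝 (∫⁻ ω, expNeg (∫⁻ p, h p ∂(M ω)) ∂P)) := by
    refine tendsto_lintegral_of_dominated_convergence (fun _ => 1)
      (fun n => measurable_expNeg.comp
        ((Measure.measurable_lintegral (s n).measurable).comp hM.measurable))
      (fun n => ae_of_all _ fun ω => expNeg_le_one _) (by simp) (ae_of_all _ fun ω => ?_)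
    exact (continuous_expNeg.tendsto _).comp (lintegral_tendsto_of_tendsto_of_monotone
      (fun n => (s n).measurable.aemeasurable) (ae_of_all _ hmono) (ae_of_all _ hlim))
  have h2 : Tendsto (fun n => expNeg (∫⁻ p, (1 - expNeg (s n p)) ∂μ)) atTop
      (𝓝 (expNeg (∫⁻ p, (1 - expNeg (h p)) ∂μ))) := by
    refine (continuous_expNeg.tendsto _).comp (lintegral_tendsto_of_tendsto_of_monotone
      (fun n => (measurable_const.sub (measurable_expNeg.comp (s n).measurable)).aemeasurable)
      (ae_of_all _ fun p m n hmn => tsub_le_tsub_left (expNeg_antitone (hmono p hmn)) _)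
      (ae_of_all _ fun p => ?_))
    exact ENNReal.Tendsto.sub tendsto_const_nhds ((continuous_expNeg.tendsto _).comp (hlim p))
      (.inl ENNReal.one_ne_top)
  refine tendsto_nhds_unique h1 (h2.congr fun n => ?_)
  exact (hM.lintegral_expNeg_simpleFunc (s n) fun p => (SimpleFunc.eapprox_lt_top h n p).ne).symm

end IsPoissonRandomMeasure

/-! ### Dyadic approximation of time, and the mean of the exponential functional. -/

/-- The smallest dyadic number of level `n` that is at least `t`. -/
noncomputable def dyadicCeil (n : ℕ) (t : ℝ) : ℝ := (⌈2 ^ n * t⌉₊ : ℝ) / 2 ^ n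

lemma le_dyadicCeil (n : ℕ) (t : ℝ) : t ≤ dyadicCeil n t := by
  rw [dyadicCeil, le_div_iff₀ (by positivity), mul_comm]
  exact Nat.le_ceil _

lemma dyadicCeil_nonneg (n : ℕ) (t : ℝ) : 0 ≤ dyadicCeil n t := by
  unfold dyadicCeil; positivity

lemma antitone_dyadicCeil (t : ℝ) : Antitone fun n => dyadicCeil n t := by
  refine antitone_nat_of_succ_le fun n => ?_
  have h : ⌈(2 : ℝ) ^ (n + 1) * t⌉₊ ≤ 2 * ⌈(2 : ℝ) ^ n * t⌉₊ := by
    refine Nat.ceil_le.2 ?_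
    have := Nat.le_ceil ((2 : ℝ) ^ n * t)
    push_cast
    rw [pow_succ]
    linarith
  have h' : (⌈(2 : ℝ) ^ (n + 1) * t⌉₊ : ℝ) ≤ 2 * ⌈(2 : ℝ) ^ n * t⌉₊ := mod_cast h
  change (⌈(2 : ℝ) ^ (n + 1) * t⌉₊ : ℝ) / 2 ^ (n + 1) ≤ (⌈(2 : ℝ) ^ n * t⌉₊ : ℝ) / 2 ^ n
  rw [div_le_div_iff₀ (by positivity) (by positivity)]
  calc _ ≤ 2 * (⌈(2 : ℝ) ^ n * t⌉₊ : ℝ) * 2 ^ n := by gcongr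
    _ = _ := by ring

lemma tendsto_dyadicCeil {t : ℝ} (ht : 0 ≤ t) :
    Tendsto (fun n => dyadicCeil n t) atTop (𝓝 t) := by
  have hlim : Tendsto (fun n : ℕ => t + (1 / 2 : ℝ) ^ n) atTop (𝓝 t) := by
    simpa using (tendsto_pow_atTop_nhds_zero_of_lt_one (r := (1 / 2 : ℝ)) (by norm_num)
      (by norm_num)).const_add t
  refine tendsto_of_tendsto_of_tendsto_of_le_of_le tendsto_const_nhds hlim
    (fun n => le_dyadicCeil n t) fun n => ?_
  have hp : (0 : ℝ) < 2 ^ n := by positivity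
  have := (Nat.ceil_lt_add_one (mul_nonneg hp.le ht)).le
  change (⌈2 ^ n * t⌉₊ : ℝ) / 2 ^ n ≤ _
  rw [div_le_iff₀ hp, add_mul, ← mul_pow]
  norm_num
  linarith

section ExpFunctional

variable {Ω : Type*} {Y : ℝ → Ω → ℝ≥0∞}

/-- A monotone path has countably many discontinuities, so no right-continuity is needed.
Approaching `t` from above makes the approximations increase, and the limit is a supremum. -/
lemma expNeg_ae_eq_iSup_dyadicCeil (hmono : ∀ ω, Monotone fun t => Y t ω) (ω : Ω) :
    ∀ᵐ t ∂(volume.restrict (Set.Ioi (0 : ℝ))),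
      expNeg (Y t ω) = ⨆ n, expNeg (Y (dyadicCeil n t) ω) := by
  have hanti : Antitone fun t => expNeg (Y t ω) := fun _ _ h => expNeg_antitone (hmono ω h)
  filter_upwards [ae_restrict_mem measurableSet_Ioi, ae_restrict_of_ae
    (hanti.countable_not_continuousAt.ae_notMem volume)] with t ht hcont
  have hcont : ContinuousAt (fun t => expNeg (Y t ω)) t := not_not.1 hcont
  refine (iSup_eq_of_tendsto (fun m n hmn => hanti (antitone_dyadicCeil t hmn)) ?_).symm
  exact hcont.tendsto.comp (tendsto_dyadicCeil (le_of_lt ht))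

lemma expFunctional_eq_lintegral_iSup (hmono : ∀ ω, Monotone fun t => Y t ω) (ω : Ω) :
    expFunctional Y ω =
      ∫⁻ t in Set.Ioi (0 : ℝ), ⨆ n, expNeg (Y (dyadicCeil n t) ω) :=
  lintegral_congr_ae (expNeg_ae_eq_iSup_dyadicCeil hmono ω)

variable [MeasurableSpace Ω]

/-- Only the countably many times k/2ⁿ enter, so measurability at each fixed time gives joint
measurability. -/
lemma measurable_iSup_expNeg_dyadicCeil (hmeas : ∀ t, Measurable (Y t)) :
    Measurable fun p : ℝ × Ω => ⨆ n, expNeg (Y (dyadicCeil n p.1) p.2) := by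
  refine Measurable.iSup fun n => measurable_expNeg.comp ?_
  have h : Measurable fun q : ℕ × Ω => Y ((q.1 : ℝ) / 2 ^ n) q.2 :=
    measurable_from_prod_countable_right fun k => hmeas ((k : ℝ) / 2 ^ n)
  exact h.comp (((measurable_fst.const_mul _).nat_ceil).prodMk measurable_snd)

lemma measurable_expFunctional (hmono : ∀ ω, Monotone fun t => Y t ω)
    (hmeas : ∀ t, Measurable (Y t)) : Measurable (expFunctional Y) := by
  rw [funext (expFunctional_eq_lintegral_iSup hmono)]
  exact (measurable_iSup_expNeg_dyadicCeil hmeas).lintegral_prod_left'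

lemma lintegral_expNeg_ofReal_mul {c : ℝ≥0∞} (hc0 : c ≠ 0) (hc : c ≠ ∞) :
    ∫⁻ t in Set.Ioi (0 : ℝ), expNeg (ENNReal.ofReal t * c) = c⁻¹ := by
  obtain ⟨x, hx, rfl⟩ : ∃ x : ℝ, 0 < x ∧ c = ENNReal.ofReal x :=
    ⟨c.toReal, ENNReal.toReal_pos hc0 hc, (ENNReal.ofReal_toReal hc).symm⟩
  have hneg : -x < 0 := by linarith
  rw [← ENNReal.ofReal_inv_of_pos hx]
  have hint := integral_exp_mul_Ioi hneg 0
  have : x⁻¹ = ∫ t in Set.Ioi (0 : ℝ), Real.exp (-x * t) := by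
    rw [hint]; simp
  rw [this, ofReal_integral_eq_lintegral_ofReal (integrableOn_exp_mul_Ioi hneg 0)
    (ae_of_all _ fun t => (Real.exp_pos _).le)]
  refine setLIntegral_congr_fun measurableSet_Ioi fun t ht => ?_
  have ht : (0 : ℝ) < t := ht
  change expNeg (ENNReal.ofReal t * ENNReal.ofReal x) = _
  rw [← ENNReal.ofReal_mul ht.le, expNeg_ofReal (by positivity)]
  congr 2; ring

/-- The mean of the exponential functional of an increasing process whose one-dimensional
marginals have the Laplace exponent `c` at `1`. -/
theorem lintegral_expFunctional {P : Measure Ω} [SFinite P]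
    (hmono : ∀ ω, Monotone fun t => Y t ω) (hmeas : ∀ t, Measurable (Y t)) {c : ℝ≥0∞}
    (hc0 : c ≠ 0) (hc : c ≠ ∞)
    (hY : ∀ t, 0 ≤ t → ∫⁻ ω, expNeg (Y t ω) ∂P = expNeg (ENNReal.ofReal t * c)) :
    ∫⁻ ω, expFunctional Y ω ∂P = c⁻¹ := by
  simp_rw [expFunctional_eq_lintegral_iSup hmono]
  -- Tonelli is applied to the supremum, whose joint measurability is known, rather than to the
  -- process itself.
  rw [lintegral_lintegral_swap (f := fun ω t => ⨆ n, expNeg (Y (dyadicCeil n t) ω))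
    ((measurable_iSup_expNeg_dyadicCeil hmeas).comp measurable_swap).aemeasurable,
    ← lintegral_expNeg_ofReal_mul hc0 hc]
  refine setLIntegral_congr_fun measurableSet_Ioi fun t ht => ?_
  have ht : (0 : ℝ) < t := ht
  change ∫⁻ ω, ⨆ n, expNeg (Y (dyadicCeil n t) ω) ∂P = _
  rw [lintegral_iSup (f := fun n ω => expNeg (Y (dyadicCeil n t) ω))
    (fun n => measurable_expNeg.comp (hmeas _))
    fun m n hmn ω => expNeg_antitone (hmono ω (antitone_dyadicCeil t hmn))]
  simp_rw [hY _ (dyadicCeil_nonneg _ t)]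
  refine iSup_eq_of_tendsto (fun m n hmn => expNeg_antitone (mul_le_mul_left
    (ENNReal.ofReal_le_ofReal (antitone_dyadicCeil t hmn)) c)) ?_
  refine (continuous_expNeg.tendsto _).comp (ENNReal.Tendsto.mul_const
    ((ENNReal.continuous_ofReal.tendsto _).comp (tendsto_dyadicCeil ht.le)) (.inr hc))

end ExpFunctional

/-! ### Laplace transforms of jump processes. -/

section JumpProcess

variable {Ω : Type*} {M : Ω → Measure (ℝ × ℝ)} {ν : Measure ℝ}

lemma monotone_jumpProcess (B : Set ℝ) (g : ℝ → ℝ≥0∞) (ω : Ω) :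
    Monotone fun t : ℝ => ∫⁻ p in Set.Icc 0 t ×ˢ B, g p.2 ∂(M ω) := fun _ _ h =>
  lintegral_mono_set (Set.prod_mono (Set.Icc_subset_Icc_right h) le_rfl)

variable [MeasurableSpace Ω] {P : Measure Ω}

lemma measurable_jumpProcess {μ : Measure (ℝ × ℝ)} (hM : IsPoissonRandomMeasure M μ P)
    {B : Set ℝ} (hB : MeasurableSet B) {g : ℝ → ℝ≥0∞} (hg : Measurable g) (t : ℝ) :
    Measurable fun ω => ∫⁻ p in Set.Icc 0 t ×ˢ B, g p.2 ∂(M ω) := by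
  simp_rw [← lintegral_indicator (measurableSet_Icc.prod hB)]
  exact (Measure.measurable_lintegral ((hg.comp measurable_snd).indicator
    (measurableSet_Icc.prod hB))).comp hM.measurable

/-- The Lévy–Khintchine formula at `1` for the subordinator with jumps `g z`, `z ∈ B`. -/
lemma lintegral_expNeg_jumpProcess [IsProbabilityMeasure P] [SFinite ν]
    (hM : IsPoissonRandomMeasure M (jumpIntensity ν) P)
    {B : Set ℝ} (hB : MeasurableSet B) {g : ℝ → ℝ≥0∞} (hg : Measurable g) {t : ℝ} :
    ∫⁻ ω, expNeg (∫⁻ p in Set.Icc 0 t ×ˢ B, g p.2 ∂(M ω)) ∂P =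
      expNeg (ENNReal.ofReal t * ∫⁻ z in B, (1 - expNeg (g z)) ∂ν) := by
  have hS : MeasurableSet (Set.Icc (0 : ℝ) t ×ˢ B) := measurableSet_Icc.prod hB
  have hgm : Measurable fun z => 1 - expNeg (g z) :=
    measurable_const.sub (measurable_expNeg.comp hg)
  simp_rw [← lintegral_indicator hS]
  rw [hM.lintegral_expNeg_lintegral (h := (Set.Icc 0 t ×ˢ B).indicator fun p => g p.2) ((hg.comp measurable_snd).indicator hS)]
  congr 1
  have : ∀ p : ℝ × ℝ, 1 - expNeg ((Set.Icc (0 : ℝ) t ×ˢ B).indicator (fun p => g p.2) p) =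
      (Set.Icc (0 : ℝ) t ×ˢ B).indicator (fun p => 1 - expNeg (g p.2)) p := by
    intro p
    by_cases hp : p ∈ Set.Icc (0 : ℝ) t ×ˢ B
    · simp [Set.indicator_of_mem hp]
    · simp [Set.indicator_of_notMem hp, expNeg_zero]
  simp_rw [this]
  rw [lintegral_indicator hS, jumpIntensity, ← Measure.prod_restrict,
    lintegral_prod (fun p : ℝ × ℝ => 1 - expNeg (g p.2)) (hgm.comp measurable_snd).aemeasurable,
    lintegral_const (∫⁻ z in B, (1 - expNeg (g z)) ∂ν), Measure.restrict_apply_univ, Measure.restrict_apply measurableSet_Icc,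
    Set.inter_eq_left.2 Set.Icc_subset_Ici_self, Real.volume_Icc, sub_zero, mul_comm]

end JumpProcess

/-! ### Pointwise inequalities for rounding to a lattice. -/

section FloorBounds

variable {ε z : ℝ}

lemma lt_mul_floor_div (hε : 0 < ε) (z : ℝ) : z - ε < ε * (⌊z / ε⌋ : ℝ) := by
  have h := Int.lt_floor_add_one (z / ε)
  rw [div_lt_iff₀ hε] at h
  linarith

lemma mul_floor_div_le (hε : 0 < ε) (z : ℝ) : ε * (⌊z / ε⌋ : ℝ) ≤ z := by
  have h := Int.floor_le (z / ε)
  rw [le_div_iff₀ hε] at h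
  linarith

lemma le_mul_floor_div (hε : 0 < ε) (hz : ε ≤ z) : ε ≤ ε * (⌊z / ε⌋ : ℝ) := by
  have h : (1 : ℤ) ≤ ⌊z / ε⌋ := Int.le_floor.2 (by rw [le_div_iff₀ hε]; push_cast; linarith)
  have h' : (1 : ℝ) ≤ ⌊z / ε⌋ := mod_cast h
  nlinarith

lemma exp_neg_sub_exp_neg_le (x y : ℝ) :
    Real.exp (-x) - Real.exp (-y) ≤ (y - x) * Real.exp (-x) := by
  have h := Real.add_one_le_exp (x - y)
  have : Real.exp (-y) = Real.exp (-x) * Real.exp (x - y) := by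
    rw [← Real.exp_add]; congr 1; ring
  rw [this]
  nlinarith [Real.exp_pos (-x)]

/-- Equivalent to e^ε ≤ (1 + ε/2)/(1 - ε/2), which is log(1 + x) ≥ 2x/(x + 2) at x = ε/(1 - ε/2). -/
lemma one_sub_exp_neg_mul_le (h0 : 0 < ε) (h1 : ε < 1) :
    (1 - Real.exp (-ε)) * (1 + ε / 2) ≤ ε := by
  have hlog := Real.le_log_one_add_of_nonneg (x := ε / (1 - ε / 2))
    (div_nonneg h0.le (by linarith))
  have hne : (1 - ε / 2) ≠ 0 := by linarith
  have e1 : 2 * (ε / (1 - ε / 2)) / (ε / (1 - ε / 2) + 2) = ε := by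
    have : ε / (1 - ε / 2) + 2 = 2 / (1 - ε / 2) := by
      rw [div_add' _ _ _ hne]; congr 1; ring
    rw [this, mul_div_assoc', div_div_div_cancel_right₀ hne, mul_div_cancel_left₀ _ two_ne_zero]
  have e2 : 1 + ε / (1 - ε / 2) = (1 + ε / 2) / (1 - ε / 2) := by
    rw [add_div' _ _ _ hne]; congr 1; ring
  rw [e1, e2, Real.le_log_iff_exp_le (div_pos (by linarith) (by linarith)),
    le_div_iff₀ (by linarith)] at hlog
  have hpos := Real.exp_pos (-ε)
  have hmul : Real.exp ε * Real.exp (-ε) = 1 := by rw [← Real.exp_add]; simp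
  nlinarith

lemma exp_neg_mul_one_sub_exp_neg_le (h0 : 0 < ε) (h1 : ε < 1) :
    (1 + ε) * (1 + ε / 2) * (Real.exp (-ε) * (1 - Real.exp (-ε))) ≤ ε := by
  have h := one_sub_exp_neg_mul_le h0 h1
  have hpos := Real.exp_pos (-ε)
  have hmul : Real.exp ε * Real.exp (-ε) = 1 := by rw [← Real.exp_add]; simp
  have hx : (1 + ε) * Real.exp (-ε) ≤ 1 := by
    nlinarith [Real.add_one_le_exp ε]
  have hle : Real.exp (-ε) ≤ 1 := Real.exp_le_one_iff.2 (by linarith)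
  calc _ = ((1 + ε) * Real.exp (-ε)) * ((1 - Real.exp (-ε)) * (1 + ε / 2)) := by ring
    _ ≤ 1 * ((1 - Real.exp (-ε)) * (1 + ε / 2)) := by
      gcongr
    _ ≤ ε := by linarith

lemma half_le_mul_floor_div (hε : 0 < ε) (hz : ε ≤ z) : z / 2 ≤ ε * (⌊z / ε⌋ : ℝ) := by
  linarith [lt_mul_floor_div hε z, le_mul_floor_div hε hz]

/-- With f the rounded jump, z ≤ f + ε bounds the loss by e^{-f}(1 - e^{-ε}), and f ≥ ε gains a
further e^{-ε}. This gain pays for the factor κ = (1 + ε)(1 + ε/2). -/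
lemma one_sub_exp_floor_bounds (h0 : 0 < ε) (h1 : ε < 1) (hz : ε ≤ z) :
    0 ≤ 1 - Real.exp (-(ε * (⌊z / ε⌋ : ℝ))) ∧
    1 - Real.exp (-(ε * (⌊z / ε⌋ : ℝ))) ≤ 1 - Real.exp (-z) ∧
    (1 + ε) * (1 + ε / 2) * ((1 - Real.exp (-z)) - (1 - Real.exp (-(ε * (⌊z / ε⌋ : ℝ))))) ≤ ε := by
  set f := ε * (⌊z / ε⌋ : ℝ) with hf
  have hf1 := lt_mul_floor_div h0 z
  have hf2 := mul_floor_div_le h0 z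
  have hf3 := le_mul_floor_div h0 hz
  rw [← hf] at hf1 hf2 hf3
  refine ⟨?_, ?_, ?_⟩
  · have : Real.exp (-f) ≤ 1 := Real.exp_le_one_iff.2 (by linarith)
    linarith
  · have : Real.exp (-z) ≤ Real.exp (-f) := Real.exp_le_exp.2 (by linarith)
    linarith
  · have hz' : Real.exp (-f) * Real.exp (-ε) ≤ Real.exp (-z) := by
      rw [← Real.exp_add]; exact Real.exp_le_exp.2 (by linarith)
    have hfe : Real.exp (-f) ≤ Real.exp (-ε) := Real.exp_le_exp.2 (by linarith)
    have hle : Real.exp (-ε) ≤ 1 := Real.exp_le_one_iff.2 (by linarith)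
    have hD : (1 - Real.exp (-z)) - (1 - Real.exp (-f)) ≤
        Real.exp (-ε) * (1 - Real.exp (-ε)) := by
      nlinarith
    exact (mul_le_mul_of_nonneg_left hD (by positivity)).trans
      (exp_neg_mul_one_sub_exp_neg_le h0 h1)

/-- Rounding to integers can exceed rounding to the `ε`-lattice only for z ≥ 1. There f > z - ε and
f ≥ ε give both f ≥ 1/2 and 2f ≥ ⌊z⌋. The last three bounds control the excess additively and
multiplicatively. -/
lemma one_sub_exp_neg_floor_le (h0 : 0 < ε) (h1 : ε < 1) (hz : ε ≤ z) :
    0 ≤ 1 - Real.exp (-(⌊z⌋ : ℝ)) ∧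
    1 - Real.exp (-(⌊z⌋ : ℝ)) ≤ 1 - Real.exp (-z) ∧
    (1 - Real.exp (-(⌊z⌋ : ℝ))) - (1 - Real.exp (-(ε * (⌊z / ε⌋ : ℝ)))) ≤
      Real.exp (-(1 / 2)) * ε ∧
    1 - Real.exp (-(⌊z⌋ : ℝ)) ≤
      (1 + Real.exp (-(1 / 2))) * (1 - Real.exp (-(ε * (⌊z / ε⌋ : ℝ)))) ∧
    1 - Real.exp (-(⌊z⌋ : ℝ)) ≤
      (1 + ε) * (1 + ε / 2) * (1 - Real.exp (-(ε * (⌊z / ε⌋ : ℝ)))) := by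
  have hF := (one_sub_exp_floor_bounds h0 h1 hz).1
  have hy := Real.exp_pos (-(1 / 2) : ℝ)
  have hfl := Int.floor_le z
  have hmono : Real.exp (-z) ≤ Real.exp (-(⌊z⌋ : ℝ)) := Real.exp_le_exp.2 (by linarith)
  set f := ε * (⌊z / ε⌋ : ℝ) with hf
  rcases lt_or_ge z 1 with hz1 | hz1
  · have hzero : ⌊z⌋ = 0 := Int.floor_eq_zero_iff.2 ⟨by linarith, hz1⟩
    have hz0 : Real.exp (-z) ≤ 1 := Real.exp_le_one_iff.2 (by linarith)
    simp only [hzero, Int.cast_zero, neg_zero, Real.exp_zero, sub_self]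
    exact ⟨le_rfl, by linarith, by nlinarith, by positivity, by positivity⟩
  · have hn : (1 : ℝ) ≤ ⌊z⌋ := by exact_mod_cast Int.le_floor.2 (by simpa using hz1)
    set n : ℝ := (⌊z⌋ : ℝ)
    have hf1 := lt_mul_floor_div h0 z
    have hf3 := le_mul_floor_div h0 hz
    rw [← hf] at hf1 hf3
    have hfpos := Real.exp_pos (-f)
    have hfhalf : 1 / 2 ≤ f := by linarith
    have hfy : Real.exp (-f) ≤ Real.exp (-(1 / 2)) := Real.exp_le_exp.2 (by linarith)
    have hdiff : Real.exp (-f) - Real.exp (-n) ≤ ε * Real.exp (-f) :=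
      (exp_neg_sub_exp_neg_le f n).trans (by gcongr; linarith)
    refine ⟨?_, by linarith, ?_, ?_, ?_⟩
    · have : Real.exp (-n) ≤ 1 := Real.exp_le_one_iff.2 (by linarith)
      linarith
    · nlinarith
    -- Uses 1 - e^{-n} ≤ 1 - e^{-2f} = (1 + e^{-f})(1 - e^{-f}).
    · have h2 : Real.exp (-f) * Real.exp (-f) ≤ Real.exp (-n) := by
        rw [← Real.exp_add]; exact Real.exp_le_exp.2 (by linarith)
      nlinarith
    · have hquad := Real.quadratic_le_exp_of_nonneg (x := f) (by linarith)
      have hmul : Real.exp f * Real.exp (-f) = 1 := by rw [← Real.exp_add]; simp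
      -- Since κ = 1 + ε(3 + ε)/2, it suffices that (3 + ε)/2 · (e^f - 1) ≥ 1. The threshold 1/5 is
      -- where f ≥ 1/2 just suffices: 8/5 · 5/8 = 1. Below it, f > 1 - ε is the better bound.
      have hkey : 1 ≤ (3 + ε) / 2 * (f + f ^ 2 / 2) := by
        rcases le_or_gt (1 / 5) ε with hε | hε
        · nlinarith
        · have : 4 / 5 ≤ f := by linarith
          nlinarith
      have hF' : Real.exp (-f) * (f + f ^ 2 / 2) ≤ 1 - Real.exp (-f) := by nlinarith
      have : ε * Real.exp (-f) ≤ ε * ((3 + ε) / 2) * (1 - Real.exp (-f)) := by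
        calc ε * Real.exp (-f) = ε * Real.exp (-f) * 1 := by ring
          _ ≤ ε * Real.exp (-f) * ((3 + ε) / 2 * (f + f ^ 2 / 2)) := by gcongr
          _ = ε * ((3 + ε) / 2) * (Real.exp (-f) * (f + f ^ 2 / 2)) := by ring
          _ ≤ _ := by gcongr
      linarith

lemma exp_neg_half_mul_one_add_le :
    Real.exp (-(1 / 2)) * (1 + Real.exp (-(1 / 2))) ≤ 1 := by
  have hquad := Real.quadratic_le_exp_of_nonneg (x := 1 / 2) (by norm_num)
  have hpos := Real.exp_pos (-(1 / 2) : ℝ)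
  have hmul : Real.exp (1 / 2 : ℝ) * Real.exp (-(1 / 2)) = 1 := by rw [← Real.exp_add]; simp
  have : Real.exp (-(1 / 2)) ≤ 8 / 13 := by nlinarith
  nlinarith

end FloorBounds

/-! ### Comparing reciprocals of Laplace exponents. -/

/-- If a ≤ φ this would be immediate. In general a(a - φ) ≤ bφ and a(Ψ - φ) ≤ bφ replace that
comparison; they handle the small-jump term s and the rounding term Ψ - φ separately. In the
application y = e^{-1/2} and κ = (1 + ε)(1 + ε/2). -/
lemma one_div_sub_one_div_le {s r b Ψ φ a y κ : ℝ} (hs : 0 ≤ s) (hsr : s ≤ r) (hb : 0 ≤ b)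
    (ha : 0 < a) (hφ : 0 < φ) (hφΨ : φ ≤ Ψ) (haΨ : a ≤ Ψ) (hy0 : 0 ≤ y) (hy : y * (1 + y) ≤ 1)
    (hay : a - φ ≤ y * b) (hay' : a ≤ (1 + y) * φ) (haκ : a ≤ κ * φ)
    (hκ : κ * (Ψ - φ) ≤ b) :
    1 / φ - 1 / (s + Ψ) ≤ 1 / a ^ 2 * (r + b) := by
  have hΨ : 0 < Ψ := hφ.trans_le hφΨ
  have h1 : a * (a - φ) ≤ b * φ := by
    rcases le_or_gt a φ with h | h
    · exact (mul_nonpos_of_nonneg_of_nonpos ha.le (by linarith)).trans (by positivity)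
    · calc a * (a - φ) ≤ ((1 + y) * φ) * (y * b) := by
            apply mul_le_mul hay' hay (by linarith) (by positivity)
        _ = (y * (1 + y)) * (b * φ) := by ring
        _ ≤ 1 * (b * φ) := by gcongr
        _ = b * φ := one_mul _
  have h2 : a * (Ψ - φ) ≤ φ * b := by
    calc a * (Ψ - φ) ≤ κ * φ * (Ψ - φ) := by
          apply mul_le_mul_of_nonneg_right haκ (by linarith)
      _ = φ * (κ * (Ψ - φ)) := by ring
      _ ≤ φ * b := by gcongr
  have h3 : a ^ 2 * s ≤ φ * (r * Ψ + b * s) := by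
    calc a ^ 2 * s = s * (a * (a - φ)) + φ * (s * a) := by ring
      _ ≤ s * (b * φ) + φ * (r * Ψ) := by
        have : s * a ≤ r * Ψ := mul_le_mul hsr haΨ ha.le (hs.trans hsr)
        gcongr
      _ = _ := by ring
  have h4 : a ^ 2 * (Ψ - φ) ≤ φ * (b * Ψ) := by
    calc a ^ 2 * (Ψ - φ) = a * (a * (Ψ - φ)) := by ring
      _ ≤ Ψ * (φ * b) := mul_le_mul haΨ h2 (mul_nonneg ha.le (by linarith)) hΨ.le
      _ = _ := by ring
  rw [div_sub_div _ _ hφ.ne' (by positivity), one_div_mul_eq_div,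
    div_le_div_iff₀ (by positivity) (by positivity)]
  have : 0 ≤ φ * (r * s) := by have := hs.trans hsr; positivity
  nlinarith

lemma one_div_sub_one_div_le' {s r b Ψ φ p : ℝ} (hs : 0 ≤ s) (hsr : s ≤ r)
    (hp : 0 < p) (hpφ : p ≤ φ) (hφΨ : φ ≤ Ψ) (hb : Ψ - φ ≤ b) :
    1 / φ - 1 / (s + Ψ) ≤ 1 / p ^ 2 * (r + b) := by
  have hφ : 0 < φ := hp.trans_le hpφ
  have hΨ : 0 < s + Ψ := by linarith
  rw [div_sub_div _ _ hφ.ne' hΨ.ne', one_div_mul_eq_div, pow_two]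
  have h1 : 1 * (s + Ψ) - φ * 1 ≤ r + b := by linarith
  gcongr
  · linarith
  · linarith

/-! ### Integrability under the Lévy measure, and the rate ϱ². -/

namespace IsSubordinatorLevyMeasure

variable {ν : Measure ℝ}

lemma ae_pos (hν : IsSubordinatorLevyMeasure ν) : ∀ᵐ z ∂ν, 0 < z := by
  rw [ae_iff]
  simpa [Set.Iic] using hν.measure_Iic

lemma measure_Ici_lt_top (hν : IsSubordinatorLevyMeasure ν) {δ : ℝ} (hδ : 0 < δ) :
    ν (Set.Ici δ) < ∞ := by
  have hpos : ENNReal.ofReal (min 1 δ) ≠ 0 := by simpa using hδ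
  have hmeas : Measurable fun z : ℝ => ENNReal.ofReal (min 1 z) := by fun_prop
  refine lt_of_le_of_lt (measure_mono fun z hz => ?_)
    ((meas_ge_le_lintegral_div hmeas.aemeasurable hpos ENNReal.ofReal_ne_top).trans_lt
      (ENNReal.div_lt_top hν.lintegral_min_lt_top.ne hpos))
  exact ENNReal.ofReal_le_ofReal (min_le_min_left 1 hz)

lemma sigmaFinite (hν : IsSubordinatorLevyMeasure ν) : SigmaFinite ν := by
  refine ⟨⟨⟨fun n : ℕ => Set.Iic 0 ∪ Set.Ici (1 / ((n : ℝ) + 1)), fun _ => trivial, fun n => ?_,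
    ?_⟩⟩⟩
  · refine (measure_union_le _ _).trans_lt ?_
    rw [hν.measure_Iic, zero_add]
    exact hν.measure_Ici_lt_top (by positivity)
  · refine Set.eq_univ_of_forall fun z => Set.mem_iUnion.2 ?_
    rcases le_or_gt z 0 with hz | hz
    · exact ⟨0, .inl hz⟩
    · obtain ⟨n, hn⟩ := exists_nat_one_div_lt hz
      exact ⟨n, .inr hn.le⟩

lemma exists_measure_Ici_pos (hν : IsSubordinatorLevyMeasure ν) (hν0 : ν ≠ 0) :
    ∃ δ : ℝ, 0 < δ ∧ δ ≤ 1 ∧ 0 < ν (Set.Ici δ) := by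
  by_contra! h
  refine hν0 (Measure.measure_univ_eq_zero.1 ?_)
  have hcover : (Set.univ : Set ℝ) ⊆ Set.Iic 0 ∪ ⋃ n : ℕ, Set.Ici (1 / ((n : ℝ) + 1)) := by
    intro z _
    rcases le_or_gt z 0 with hz | hz
    · exact .inl hz
    · obtain ⟨n, hn⟩ := exists_nat_one_div_lt hz
      exact .inr (Set.mem_iUnion.2 ⟨n, hn.le⟩)
  refine measure_mono_null hcover (measure_union_null hν.measure_Iic
    (measure_iUnion_null fun n => nonpos_iff_eq_zero.1 (h _ (by positivity) ?_)))
  rw [div_le_one (by positivity)]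
  linarith [n.cast_nonneg (α := ℝ)]

lemma integrable_min_one (hν : IsSubordinatorLevyMeasure ν) :
    Integrable (fun z : ℝ => min 1 z) ν := by
  refine ⟨by fun_prop, ?_⟩
  rw [hasFiniteIntegral_iff_ofReal (hν.ae_pos.mono fun z hz => le_min zero_le_one hz.le)]
  exact hν.lintegral_min_lt_top

lemma integrable_of_le_min (hν : IsSubordinatorLevyMeasure ν) {f : ℝ → ℝ} (hf : Measurable f)
    (h0 : ∀ z, 0 < z → 0 ≤ f z) (h1 : ∀ z, 0 < z → f z ≤ min 1 z) : Integrable f ν := by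
  refine hν.integrable_min_one.mono' hf.aestronglyMeasurable (hν.ae_pos.mono fun z hz => ?_)
  rw [Real.norm_of_nonneg (h0 z hz)]
  exact h1 z hz

lemma integrableOn_Ici_of_mem_Icc (hν : IsSubordinatorLevyMeasure ν) {δ : ℝ} (hδ : 0 < δ)
    {f : ℝ → ℝ} (hf : Measurable f) (h : ∀ z, δ ≤ z → 0 ≤ f z ∧ f z ≤ 1) :
    IntegrableOn f (Set.Ici δ) ν := by
  refine Measure.integrableOn_of_bounded (M := 1) (hν.measure_Ici_lt_top hδ).ne
    hf.aestronglyMeasurable ?_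
  filter_upwards [ae_restrict_mem measurableSet_Ici] with z hz
  rw [Real.norm_of_nonneg (h z hz).1]
  exact (h z hz).2

lemma integrable_one_sub_exp_neg (hν : IsSubordinatorLevyMeasure ν) :
    Integrable (fun z : ℝ => 1 - Real.exp (-z)) ν := by
  refine hν.integrable_of_le_min (by fun_prop) (fun z hz => ?_) fun z hz => le_min ?_ ?_
  · linarith [Real.exp_le_one_iff.2 (by linarith : -z ≤ 0)]
  · linarith [Real.exp_pos (-z)]
  · linarith [Real.add_one_le_exp (-z)]

lemma integrable_min (hν : IsSubordinatorLevyMeasure ν) {ε : ℝ} (h0 : 0 < ε) (h1 : ε ≤ 1) :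
    Integrable (fun z : ℝ => min z ε) ν :=
  hν.integrable_of_le_min (by fun_prop) (fun _ hz => le_min hz.le h0.le)
    fun _ _ => le_min ((min_le_right _ _).trans h1) (min_le_left _ _)

/-- Layer-cake formula for z ↦ min(z, ε), whose superlevel sets are [t, ∞) for 0 < t ≤ ε and empty
for t > ε. -/
lemma rateRho_sq (hν : IsSubordinatorLevyMeasure ν) {ε : ℝ} (h0 : 0 < ε) :
    rateRho ν ε ^ 2 = ∫ z, min z ε ∂ν := by
  have hnonneg : 0 ≤ᵐ[ν] fun z => min z ε := hν.ae_pos.mono fun z hz => le_min hz.le h0.le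
  have hanti : Antitone fun z : ℝ => ν (Set.Ici z) := fun _ _ h =>
    measure_mono (Set.Ici_subset_Ici.2 h)
  rw [rateRho, Real.sq_sqrt (integral_nonneg fun _ => ENNReal.toReal_nonneg),
    integral_toReal hanti.measurable.aemeasurable,
    integral_eq_lintegral_of_nonneg_ae hnonneg (by fun_prop),
    lintegral_eq_lintegral_meas_le ν hnonneg (by fun_prop)]
  · congr 1
    rw [← lintegral_indicator measurableSet_Ioc, ← lintegral_indicator measurableSet_Ioi]
    congr 1
    ext t
    by_cases ht : 0 < t
    · by_cases htε : t ≤ ε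
      · rw [Set.indicator_of_mem (Set.mem_Ioc.2 ⟨ht, htε⟩),
          Set.indicator_of_mem (Set.mem_Ioi.2 ht)]
        congr 1
        ext z
        simp [htε]
      · rw [Set.indicator_of_notMem (fun h : t ∈ Set.Ioc 0 ε => htε h.2),
          Set.indicator_of_mem (Set.mem_Ioi.2 ht)]
        have : {z : ℝ | t ≤ min z ε} = ∅ := by
          ext z
          simp [htε]
        rw [this, measure_empty]
    · rw [Set.indicator_of_notMem (fun h : t ∈ Set.Ioc 0 ε => ht h.1),
        Set.indicator_of_notMem (fun h : t ∈ Set.Ioi 0 => ht h)]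
  · filter_upwards [ae_restrict_mem measurableSet_Ioc] with z hz
    exact hν.measure_Ici_lt_top hz.1

lemma rateRho_sq_eq_add (hν : IsSubordinatorLevyMeasure ν) {ε : ℝ} (h0 : 0 < ε) (h1 : ε ≤ 1) :
    rateRho ν ε ^ 2 = (∫ z in Set.Iio ε, z ∂ν) + ∫ _ in Set.Ici ε, ε ∂ν := by
  rw [hν.rateRho_sq h0, ← integral_add_compl measurableSet_Iio (hν.integrable_min h0 h1),
    Set.compl_Iio]
  congr 1
  · exact setIntegral_congr_fun measurableSet_Iio fun z hz => min_eq_left (le_of_lt hz)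
  · exact setIntegral_congr_fun measurableSet_Ici fun z hz => min_eq_right hz

lemma tendsto_rateRho_sq (hν : IsSubordinatorLevyMeasure ν) :
    Tendsto (fun ε : ℝ => rateRho ν ε ^ 2) (𝓝[>] 0) (𝓝 0) := by
  have hlim : Tendsto (fun ε : ℝ => ∫ z, min z ε ∂ν) (𝓝[>] 0) (𝓝 (∫ _, (0 : ℝ) ∂ν)) := by
    refine tendsto_integral_filter_of_dominated_convergence (fun z => min 1 z)
      (.of_forall fun ε => by fun_prop) ?_ hν.integrable_min_one ?_
    · filter_upwards [Ioo_mem_nhdsGT (zero_lt_one' ℝ)] with ε hε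
      filter_upwards [hν.ae_pos] with z hz
      rw [Real.norm_of_nonneg (le_min hz.le hε.1.le)]
      exact le_min ((min_le_right _ _).trans hε.2.le) (min_le_left _ _)
    · filter_upwards [hν.ae_pos] with z hz
      have : Tendsto (fun ε : ℝ => min z ε) (𝓝 0) (𝓝 (min z 0)) :=
        (continuous_const.min continuous_id).tendsto 0
      rw [min_eq_right hz.le] at this
      exact this.mono_left nhdsWithin_le_nhds
  rw [integral_zero] at hlim
  refine hlim.congr' ?_
  filter_upwards [Ioo_mem_nhdsGT (zero_lt_one' ℝ)] with ε hε
  exact (hν.rateRho_sq hε.1).symm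

end IsSubordinatorLevyMeasure

/-! ### Laplace exponents of the discretisations. -/

/-- The Laplace exponent at `u` of the discretisation on the integer lattice. -/
lemma latticeLaplaceExponent_one (ν : Measure ℝ) {u : ℝ} (hu : 0 < u) :
    latticeLaplaceExponent ν 1 u =
      ∫ z in Set.Ici 1, (1 - Real.exp (-(u * (⌊z⌋ : ℝ)))) ∂ν := by
  have hnonneg : ∀ x : ℝ, 0 ≤ x → 0 ≤ 1 - Real.exp (-(u * x)) := fun x hx => by
    have : 0 ≤ u * x := by positivity
    linarith [Real.exp_le_one_iff.2 (by linarith : -(u * x) ≤ 0)]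
  have hfloor : ∀ z : ℝ, z ∈ Set.Ici (1 : ℝ) → (0 : ℝ) ≤ ⌊z⌋ := fun z hz => by
    exact_mod_cast Int.floor_nonneg.2 (zero_le_one.trans hz)
  have hunion : Set.Ici (1 : ℝ) = ⋃ j : ℕ, Set.Ico ((j : ℝ) + 1) ((j : ℝ) + 2) := by
    ext z
    simp only [Set.mem_Ici, Set.mem_iUnion, Set.mem_Ico]
    constructor
    · intro hz
      refine ⟨⌊z - 1⌋₊, ?_, ?_⟩
      · linarith [Nat.floor_le (by linarith : 0 ≤ z - 1)]
      · linarith [Nat.lt_floor_add_one (z - 1)]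
    · rintro ⟨j, hj, -⟩
      linarith [j.cast_nonneg (α := ℝ)]
  have hfl : ∀ (j : ℕ) (z : ℝ), z ∈ Set.Ico ((j : ℝ) + 1) ((j : ℝ) + 2) →
      (⌊z⌋ : ℝ) = (j : ℝ) + 1 := fun j z hz => by
    have : ⌊z⌋ = (j : ℤ) + 1 := Int.floor_eq_iff.2
      ⟨by push_cast; exact hz.1, by push_cast; linarith [hz.2]⟩
    rw [this]; push_cast; ring
  have hdisj : Pairwise (Function.onFun Disjoint
      fun j : ℕ => Set.Ico ((j : ℝ) + 1) ((j : ℝ) + 2)) := by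
    intro i j hij
    refine Set.disjoint_left.2 fun z hi hj => hij ?_
    have := (hfl i z hi).symm.trans (hfl j z hj)
    exact_mod_cast add_right_cancel this
  rw [latticeLaplaceExponent, laplaceExponent,
    integral_eq_lintegral_of_nonneg_ae _ (by fun_prop),
    integral_eq_lintegral_of_nonneg_ae _ (by fun_prop)]
  · congr 1
    rw [latticeLevyMeasure, Measure.restrict_sum _ measurableSet_Ioi, lintegral_sum_measure,
      hunion, lintegral_iUnion (fun _ => measurableSet_Ico) hdisj]
    refine tsum_congr fun j => ?_
    rw [Measure.restrict_smul, lintegral_smul_measure, one_mul, one_mul,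
      Measure.restrict_eq_self_of_ae_mem, lintegral_dirac]
    · rw [setLIntegral_congr_fun (g := fun _ => ENNReal.ofReal
        (1 - Real.exp (-(u * ((j : ℝ) + 1))))) measurableSet_Ico fun z hz => by
          simp only [hfl j z hz], setLIntegral_const, smul_eq_mul, mul_comm]
    · exact (ae_dirac_iff (p := fun x => x ∈ Set.Ioi (0 : ℝ)) measurableSet_Ioi).2
        (Set.mem_Ioi.2 (by positivity))
  · filter_upwards [ae_restrict_mem measurableSet_Ici] with z hz
    exact hnonneg _ (hfloor z hz)
  · filter_upwards [ae_restrict_mem measurableSet_Ioi] with z hz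
    exact hnonneg _ (le_of_lt hz)

/-- The value at `1` of the Laplace exponent of the lattice discretisation, as an integral
against the original Lévy measure. -/
noncomputable def floorExponent (ν : Measure ℝ) (ε : ℝ) : ℝ :=
  ∫ z in Set.Ici ε, (1 - Real.exp (-(ε * (⌊z / ε⌋ : ℝ)))) ∂ν

namespace IsSubordinatorLevyMeasure

variable {ν : Measure ℝ}

lemma lintegral_one_sub_expNeg (hν : IsSubordinatorLevyMeasure ν) :
    ∫⁻ z in Set.Ioi 0, (1 - expNeg (ENNReal.ofReal z)) ∂ν =
      ENNReal.ofReal (∫ z, (1 - Real.exp (-z)) ∂ν) := by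
  have hIoi : ν.restrict (Set.Ioi 0) = ν :=
    Measure.restrict_eq_self_of_ae_mem hν.ae_pos
  rw [hIoi, ofReal_integral_eq_lintegral_ofReal hν.integrable_one_sub_exp_neg
    (hν.ae_pos.mono fun z hz => ?_)]
  · refine lintegral_congr_ae (hν.ae_pos.mono fun z hz => ?_)
    change 1 - expNeg (ENNReal.ofReal z) = ENNReal.ofReal (1 - Real.exp (-z))
    rw [expNeg_ofReal hz.le, ENNReal.ofReal_sub _ (Real.exp_pos _).le, ENNReal.ofReal_one]
  · change 0 ≤ 1 - Real.exp (-z)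
    linarith [Real.exp_le_one_iff.2 (by linarith : -z ≤ 0)]

lemma integrableOn_floor (hν : IsSubordinatorLevyMeasure ν) {ε : ℝ} (h0 : 0 < ε) :
    IntegrableOn (fun z => 1 - Real.exp (-(ε * (⌊z / ε⌋ : ℝ)))) (Set.Ici ε) ν := by
  refine hν.integrableOn_Ici_of_mem_Icc h0 (by fun_prop) fun z hz => ⟨?_, ?_⟩
  · have := le_mul_floor_div h0 hz
    linarith [Real.exp_le_one_iff.2 (by linarith : -(ε * (⌊z / ε⌋ : ℝ)) ≤ 0)]
  · linarith [Real.exp_pos (-(ε * (⌊z / ε⌋ : ℝ)))]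

lemma lintegral_one_sub_expNeg_floor (hν : IsSubordinatorLevyMeasure ν) {ε : ℝ} (h0 : 0 < ε) :
    ∫⁻ z in Set.Ici ε, (1 - expNeg (ENNReal.ofReal (ε * (⌊z / ε⌋ : ℝ)))) ∂ν =
      ENNReal.ofReal (floorExponent ν ε) := by
  rw [floorExponent, ofReal_integral_eq_lintegral_ofReal (hν.integrableOn_floor h0)]
  · refine setLIntegral_congr_fun measurableSet_Ici fun z hz => ?_
    have := le_mul_floor_div h0 hz
    change 1 - expNeg (ENNReal.ofReal (ε * (⌊z / ε⌋ : ℝ))) =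
      ENNReal.ofReal (1 - Real.exp (-(ε * (⌊z / ε⌋ : ℝ))))
    rw [expNeg_ofReal (by linarith), ENNReal.ofReal_sub _ (Real.exp_pos _).le, ENNReal.ofReal_one]
  · filter_upwards [ae_restrict_mem measurableSet_Ici] with z hz
    have := le_mul_floor_div h0 hz
    change 0 ≤ 1 - Real.exp (-(ε * (⌊z / ε⌋ : ℝ)))
    linarith [Real.exp_le_one_iff.2 (by linarith : -(ε * (⌊z / ε⌋ : ℝ)) ≤ 0)]

/-- Rounding down loses at most half of a jump z ≥ ε, so jumps above `δ` stay above δ/2. The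
resulting bound does not depend on `ε`. -/
lemma le_floorExponent (hν : IsSubordinatorLevyMeasure ν) {ε δ : ℝ} (h0 : 0 < ε) (h : ε ≤ δ) :
    (1 - Real.exp (-(δ / 2))) * ν.real (Set.Ici δ) ≤ floorExponent ν ε := by
  have hint := hν.integrableOn_floor h0
  have hsub : Set.Ici δ ⊆ Set.Ici ε := Set.Ici_subset_Ici.2 h
  have hconst : ∫ _ in Set.Ici δ, (1 - Real.exp (-(δ / 2))) ∂ν =
      (1 - Real.exp (-(δ / 2))) * ν.real (Set.Ici δ) := by
    rw [setIntegral_const, smul_eq_mul, mul_comm]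
  rw [← hconst]
  refine (setIntegral_mono_on (integrableOn_const (hν.measure_Ici_lt_top (h0.trans_le h)).ne)
    (hint.mono_set hsub) measurableSet_Ici fun z hz => ?_).trans
    (setIntegral_mono_set hint ?_ (ae_of_all _ hsub))
  · have h1 := half_le_mul_floor_div h0 (h.trans hz)
    have hz : δ ≤ z := hz
    linarith [Real.exp_le_exp.2 (by linarith : -(ε * (⌊z / ε⌋ : ℝ)) ≤ -(δ / 2))]
  · filter_upwards [ae_restrict_mem measurableSet_Ici] with z hz
    have := le_mul_floor_div h0 hz
    change 0 ≤ 1 - Real.exp (-(ε * (⌊z / ε⌋ : ℝ)))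
    linarith [Real.exp_le_one_iff.2 (by linarith : -(ε * (⌊z / ε⌋ : ℝ)) ≤ 0)]

lemma le_floorExponent_pos (hν : IsSubordinatorLevyMeasure ν) {δ : ℝ} (h0 : 0 < δ)
    (h : 0 < ν (Set.Ici δ)) : 0 < (1 - Real.exp (-(δ / 2))) * ν.real (Set.Ici δ) := by
  refine mul_pos ?_ (ENNReal.toReal_pos h.ne' (hν.measure_Ici_lt_top h0).ne)
  linarith [Real.exp_lt_one_iff.2 (by linarith : -(δ / 2) < 0)]

lemma integral_small_jumps (hν : IsSubordinatorLevyMeasure ν) {ε : ℝ} (h1 : ε ≤ 1) :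
    0 ≤ ∫ z in Set.Iio ε, (1 - Real.exp (-z)) ∂ν ∧
      ∫ z in Set.Iio ε, (1 - Real.exp (-z)) ∂ν ≤ ∫ z in Set.Iio ε, z ∂ν := by
  constructor
  · refine integral_nonneg_of_ae ((ae_restrict_of_ae hν.ae_pos).mono fun z hz => ?_)
    change 0 ≤ 1 - Real.exp (-z)
    linarith [Real.exp_le_one_iff.2 (by linarith : -z ≤ 0)]
  · refine integral_mono_of_nonneg ((ae_restrict_of_ae hν.ae_pos).mono fun z hz => ?_)
      ((hν.integrable_min_one.integrableOn (s := Set.Iio ε)).congr_fun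
        (fun z hz => min_eq_right (le_of_lt (lt_of_lt_of_le hz h1))) measurableSet_Iio)
      (ae_of_all _ fun z => ?_)
    · change 0 ≤ 1 - Real.exp (-z)
      linarith [Real.exp_le_one_iff.2 (by linarith : -z ≤ 0)]
    · change 1 - Real.exp (-z) ≤ z
      linarith [Real.add_one_le_exp (-z)]

lemma floorExponent_le (hν : IsSubordinatorLevyMeasure ν) {ε : ℝ} (h0 : 0 < ε) (h1 : ε < 1) :
    floorExponent ν ε ≤ ∫ z in Set.Ici ε, (1 - Real.exp (-z)) ∂ν ∧
      (1 + ε) * (1 + ε / 2) *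
        ((∫ z in Set.Ici ε, (1 - Real.exp (-z)) ∂ν) - floorExponent ν ε) ≤
          ∫ _ in Set.Ici ε, ε ∂ν := by
  have hint := hν.integrableOn_floor h0
  have hint' := hν.integrable_one_sub_exp_neg.integrableOn (s := Set.Ici ε)
  refine ⟨setIntegral_mono_on hint hint' measurableSet_Ici fun z hz =>
    (one_sub_exp_floor_bounds h0 h1 hz).2.1, ?_⟩
  rw [floorExponent, ← integral_sub hint' hint, ← integral_const_mul]
  exact setIntegral_mono_on ((hint'.sub hint).const_mul _)
    (integrableOn_const (hν.measure_Ici_lt_top h0).ne) measurableSet_Ici fun z hz =>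
      (one_sub_exp_floor_bounds h0 h1 hz).2.2

/-- Integrated form of the pointwise bounds. The integral over [1, ∞) is Ψ^(1)(1), and it may be
taken over [ε, ∞) because ⌊z⌋ = 0 on [ε, 1). -/
lemma integral_floor_bounds (hν : IsSubordinatorLevyMeasure ν) {ε : ℝ} (h0 : 0 < ε)
    (h1 : ε < 1) :
    ∫ z in Set.Ici 1, (1 - Real.exp (-(⌊z⌋ : ℝ))) ∂ν ≤
      ∫ z in Set.Ici ε, (1 - Real.exp (-z)) ∂ν ∧
    (∫ z in Set.Ici 1, (1 - Real.exp (-(⌊z⌋ : ℝ))) ∂ν) - floorExponent ν ε ≤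
      Real.exp (-(1 / 2)) * ∫ _ in Set.Ici ε, ε ∂ν ∧
    ∫ z in Set.Ici 1, (1 - Real.exp (-(⌊z⌋ : ℝ))) ∂ν ≤
      (1 + Real.exp (-(1 / 2))) * floorExponent ν ε ∧
    ∫ z in Set.Ici 1, (1 - Real.exp (-(⌊z⌋ : ℝ))) ∂ν ≤
      (1 + ε) * (1 + ε / 2) * floorExponent ν ε := by
  have hF := hν.integrableOn_floor h0
  have hE := hν.integrable_one_sub_exp_neg.integrableOn (s := Set.Ici ε)
  have hA : IntegrableOn (fun z : ℝ => 1 - Real.exp (-(⌊z⌋ : ℝ))) (Set.Ici ε) ν :=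
    hν.integrableOn_Ici_of_mem_Icc h0 (by fun_prop) fun z hz =>
      ⟨(one_sub_exp_neg_floor_le h0 h1 hz).1, by linarith [Real.exp_pos (-(⌊z⌋ : ℝ))]⟩
  have hβ : IntegrableOn (fun _ : ℝ => ε) (Set.Ici ε) ν :=
    integrableOn_const (hν.measure_Ici_lt_top h0).ne
  have heq : ∫ z in Set.Ici ε, (1 - Real.exp (-(⌊z⌋ : ℝ))) ∂ν =
      ∫ z in Set.Ici 1, (1 - Real.exp (-(⌊z⌋ : ℝ))) ∂ν := by
    refine setIntegral_eq_of_subset_of_forall_sdiff_eq_zero measurableSet_Ici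
      (Set.Ici_subset_Ici.2 h1.le) fun z hz => ?_
    have hz0 : ε ≤ z := hz.1
    have hz1 : z < 1 := not_le.1 hz.2
    rw [Int.floor_eq_zero_iff.2 ⟨by linarith, hz1⟩]
    simp
  rw [← heq]
  refine ⟨?_, ?_, ?_, ?_⟩
  · exact setIntegral_mono_on hA hE measurableSet_Ici fun z hz =>
      (one_sub_exp_neg_floor_le h0 h1 hz).2.1
  · rw [floorExponent, ← integral_sub hA hF, ← integral_const_mul]
    exact setIntegral_mono_on (hA.sub hF) (hβ.const_mul _) measurableSet_Ici fun z hz =>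
      (one_sub_exp_neg_floor_le h0 h1 hz).2.2.1
  · rw [floorExponent, ← integral_const_mul]
    exact setIntegral_mono_on hA (hF.const_mul _) measurableSet_Ici fun z hz =>
      (one_sub_exp_neg_floor_le h0 h1 hz).2.2.2.1
  · rw [floorExponent, ← integral_const_mul]
    exact setIntegral_mono_on hA (hF.const_mul _) measurableSet_Ici fun z hz =>
      (one_sub_exp_neg_floor_le h0 h1 hz).2.2.2.2

lemma integral_eq_add (hν : IsSubordinatorLevyMeasure ν) (ε : ℝ) :
    ∫ z, (1 - Real.exp (-z)) ∂ν =
      (∫ z in Set.Iio ε, (1 - Real.exp (-z)) ∂ν) +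
        ∫ z in Set.Ici ε, (1 - Real.exp (-z)) ∂ν := by
  rw [← integral_add_compl measurableSet_Iio hν.integrable_one_sub_exp_neg, Set.compl_Iio]

lemma latticeLaplaceExponent_one_pos (hν : IsSubordinatorLevyMeasure ν)
    (h : 0 < ν (Set.Ici 1)) {u : ℝ} (hu : 0 < u) : 0 < latticeLaplaceExponent ν 1 u := by
  rw [latticeLaplaceExponent_one ν hu]
  have hfloor : ∀ z : ℝ, z ∈ Set.Ici (1 : ℝ) → (1 : ℝ) ≤ ⌊z⌋ := fun z hz => by
    exact_mod_cast Int.le_floor.2 (by simpa using hz)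
  have hle : ∀ z : ℝ, z ∈ Set.Ici (1 : ℝ) →
      1 - Real.exp (-u) ≤ 1 - Real.exp (-(u * (⌊z⌋ : ℝ))) := fun z hz => by
    have := le_mul_of_one_le_right hu.le (hfloor z hz)
    linarith [Real.exp_le_exp.2 (by linarith : -(u * (⌊z⌋ : ℝ)) ≤ -u)]
  have hupos : 0 < 1 - Real.exp (-u) := by linarith [Real.exp_lt_one_iff.2 (by linarith : -u < 0)]
  calc 0 < ν.real (Set.Ici 1) * (1 - Real.exp (-u)) :=
        mul_pos (ENNReal.toReal_pos h.ne' (hν.measure_Ici_lt_top one_pos).ne) hupos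
    _ = ∫ _ in Set.Ici (1 : ℝ), (1 - Real.exp (-u)) ∂ν := by rw [setIntegral_const, smul_eq_mul]
    _ ≤ _ := setIntegral_mono_on (integrableOn_const (hν.measure_Ici_lt_top one_pos).ne)
        (hν.integrableOn_Ici_of_mem_Icc one_pos (by fun_prop) fun z hz =>
          ⟨hupos.le.trans (hle z hz), by linarith [Real.exp_pos (-(u * (⌊z⌋ : ℝ)))]⟩)
        measurableSet_Ici hle

end IsSubordinatorLevyMeasure

/-! ### The constants as Gamma integrals. -/

lemma constOne_eq {ν : Measure ℝ} (h : 0 < latticeLaplaceExponent ν 1 1) :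
    constOne ν = 1 / latticeLaplaceExponent ν 1 1 ^ 2 := by
  have := Real.integral_rpow_mul_exp_neg_mul_Ioi (a := 2) two_pos h
  rw [show (2 : ℝ) - 1 = 1 by norm_num, Real.Gamma_two, mul_one, Real.rpow_two] at this
  rw [constOne, ← one_div_pow, ← this]
  simp_rw [Real.rpow_one, mul_comm (latticeLaplaceExponent ν 1 1)]

lemma constTwo_eq {ν : Measure ℝ} (h : 0 < latticeLaplaceExponent ν 1 2) :
    constTwo ν = Real.sqrt (2 * Real.pi) / latticeLaplaceExponent ν 1 2 ^ (3 / 2 : ℝ) := by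
  have hint := Real.integral_rpow_mul_exp_neg_mul_Ioi (a := 3 / 2) (by norm_num) (half_pos h)
  have hΓ : Real.Gamma (3 / 2) = √Real.pi / 2 := by
    rw [show (3 / 2 : ℝ) = 1 / 2 + 1 by norm_num, Real.Gamma_add_one (by norm_num),
      Real.Gamma_one_half_eq]
    ring
  have h2 : (2 : ℝ) ^ (3 / 2 : ℝ) = 2 * √2 := by
    rw [show (3 / 2 : ℝ) = 1 + 1 / 2 by norm_num, Real.rpow_add two_pos, Real.rpow_one,
      Real.sqrt_eq_rpow]
  rw [show (3 / 2 : ℝ) - 1 = 1 / 2 by norm_num, hΓ, one_div_div,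
    Real.div_rpow two_pos.le h.le, h2] at hint
  rw [constTwo, Real.sqrt_mul two_pos.le]
  calc _ = ∫ t in Set.Ioi 0, t ^ (1 / 2 : ℝ) *
        Real.exp (-(latticeLaplaceExponent ν 1 2 / 2 * t)) := by
        simp_rw [Real.sqrt_eq_rpow]
        congr 1; ext t; congr 3; ring
    _ = _ := by rw [hint]; ring

/-! ### Pathwise comparison and the L¹ bounds. -/

section Comparison

variable {Ω : Type*} {M : Ω → Measure (ℝ × ℝ)} {ν : Measure ℝ}

lemma integral_one_sub_exp_neg_pos (hν : IsSubordinatorLevyMeasure ν) {ε : ℝ} (h0 : 0 < ε)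
    (h1 : ε < 1) (h : 0 < floorExponent ν ε) : 0 < ∫ z, (1 - Real.exp (-z)) ∂ν := by
  rw [hν.integral_eq_add ε]
  linarith [(hν.integral_small_jumps h1.le).1, (hν.floorExponent_le h0 h1).1]

lemma latticeSubordinator_le {ε : ℝ} (h0 : 0 < ε) (t : ℝ) (ω : Ω) :
    latticeSubordinator M ε t ω ≤ pureJumpSubordinator M t ω := by
  have hsub : Set.Icc 0 t ×ˢ Set.Ici ε ⊆ Set.Icc 0 t ×ˢ Set.Ioi (0 : ℝ) :=
    Set.prod_mono_right fun _ hz => h0.trans_le hz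
  exact lintegral_mono' (Measure.restrict_mono hsub le_rfl)
    fun p => ENNReal.ofReal_le_ofReal (mul_floor_div_le h0 p.2)

lemma expFunctional_le_lattice {ε : ℝ} (h0 : 0 < ε) (ω : Ω) :
    expFunctional (pureJumpSubordinator M) ω ≤ expFunctional (latticeSubordinator M ε) ω :=
  lintegral_mono fun t => expNeg_antitone (latticeSubordinator_le h0 t ω)

variable [MeasurableSpace Ω] {P : Measure Ω}

lemma measurable_expFunctional_pureJump {μ : Measure (ℝ × ℝ)}
    (hM : IsPoissonRandomMeasure M μ P) :
    Measurable (expFunctional (pureJumpSubordinator M)) :=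
  measurable_expFunctional (monotone_jumpProcess _ _)
    (measurable_jumpProcess hM measurableSet_Ioi ENNReal.measurable_ofReal)

lemma measurable_expFunctional_lattice {μ : Measure (ℝ × ℝ)}
    (hM : IsPoissonRandomMeasure M μ P) (ε : ℝ) :
    Measurable (expFunctional (latticeSubordinator M ε)) :=
  measurable_expFunctional (monotone_jumpProcess _ fun z => ENNReal.ofReal (ε * (⌊z / ε⌋ : ℝ)))
    (measurable_jumpProcess hM measurableSet_Ici
      (g := fun z => ENNReal.ofReal (ε * (⌊z / ε⌋ : ℝ))) (by fun_prop))

variable [IsProbabilityMeasure P]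

lemma lintegral_expFunctional_pureJump (hν : IsSubordinatorLevyMeasure ν)
    (hM : IsPoissonRandomMeasure M (jumpIntensity ν) P)
    (h : 0 < ∫ z, (1 - Real.exp (-z)) ∂ν) :
    ∫⁻ ω, expFunctional (pureJumpSubordinator M) ω ∂P =
      ENNReal.ofReal (1 / ∫ z, (1 - Real.exp (-z)) ∂ν) := by
  have := hν.sigmaFinite
  rw [one_div, ENNReal.ofReal_inv_of_pos h]
  refine lintegral_expFunctional (monotone_jumpProcess _ _)
    (measurable_jumpProcess hM measurableSet_Ioi ENNReal.measurable_ofReal)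
    (by simpa using h) ENNReal.ofReal_ne_top fun t _ => ?_
  rw [← hν.lintegral_one_sub_expNeg]
  exact lintegral_expNeg_jumpProcess hM measurableSet_Ioi ENNReal.measurable_ofReal

lemma lintegral_expFunctional_lattice (hν : IsSubordinatorLevyMeasure ν)
    (hM : IsPoissonRandomMeasure M (jumpIntensity ν) P) {ε : ℝ} (h0 : 0 < ε)
    (h : 0 < floorExponent ν ε) :
    ∫⁻ ω, expFunctional (latticeSubordinator M ε) ω ∂P =
      ENNReal.ofReal (1 / floorExponent ν ε) := by
  have := hν.sigmaFinite
  have hg : Measurable fun z : ℝ => ENNReal.ofReal (ε * (⌊z / ε⌋ : ℝ)) := by fun_prop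
  rw [one_div, ENNReal.ofReal_inv_of_pos h]
  refine lintegral_expFunctional (monotone_jumpProcess _ _)
    (measurable_jumpProcess hM measurableSet_Ici hg)
    (by simpa using h) ENNReal.ofReal_ne_top fun t _ => ?_
  rw [← hν.lintegral_one_sub_expNeg_floor h0]
  exact lintegral_expNeg_jumpProcess hM measurableSet_Ici hg

/-- The `L¹` distance of the two exponential functionals is the difference of their means. -/
lemma l1Distance_eq (hν : IsSubordinatorLevyMeasure ν)
    (hM : IsPoissonRandomMeasure M (jumpIntensity ν) P) {ε : ℝ} (h0 : 0 < ε) (h1 : ε < 1)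
    (h : 0 < floorExponent ν ε) :
    l1Distance P (expFunctional (pureJumpSubordinator M))
        (expFunctional (latticeSubordinator M ε)) =
      ENNReal.ofReal (1 / floorExponent ν ε - 1 / ∫ z, (1 - Real.exp (-z)) ∂ν) := by
  have hpos := integral_one_sub_exp_neg_pos hν h0 h1 h
  have hX := lintegral_expFunctional_pureJump hν hM hpos
  rw [l1Distance, ENNReal.ofReal_sub _ (by positivity), ← hX,
    ← lintegral_expFunctional_lattice hν hM h0 h,
    ← lintegral_sub (measurable_expFunctional_pureJump hM) (hX ▸ ENNReal.ofReal_ne_top)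
      (ae_of_all _ (expFunctional_le_lattice h0))]
  exact lintegral_congr fun ω => by
    rw [tsub_eq_zero_of_le (expFunctional_le_lattice h0 ω), zero_add]

lemma l1Distance_le_constOne (hν : IsSubordinatorLevyMeasure ν)
    (hM : IsPoissonRandomMeasure M (jumpIntensity ν) P) (h : 0 < ν (Set.Ici 1)) {ε : ℝ}
    (h0 : 0 < ε) (h1 : ε < 1) :
    l1Distance P (expFunctional (pureJumpSubordinator M))
        (expFunctional (latticeSubordinator M ε)) ≤
      ENNReal.ofReal (constOne ν * rateRho ν ε ^ 2) := by
  have hφ : 0 < floorExponent ν ε :=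
    (hν.le_floorExponent_pos one_pos h).trans_le (hν.le_floorExponent h0 h1.le)
  have ha := hν.latticeLaplaceExponent_one_pos h one_pos
  obtain ⟨hs, hsr⟩ := hν.integral_small_jumps h1.le
  obtain ⟨hφΨ, hκ⟩ := hν.floorExponent_le h0 h1
  obtain ⟨haΨ, hay, hay', haκ⟩ := hν.integral_floor_bounds h0 h1
  have hβ : 0 ≤ ∫ _ in Set.Ici ε, ε ∂ν := integral_nonneg fun _ => h0.le
  have hlat := latticeLaplaceExponent_one ν one_pos
  simp only [one_mul] at hlat
  rw [l1Distance_eq hν hM h0 h1 hφ, constOne_eq ha, hν.rateRho_sq_eq_add h0 h1.le,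
    hν.integral_eq_add ε]
  rw [hlat] at ha ⊢
  exact ENNReal.ofReal_le_ofReal (one_div_sub_one_div_le hs hsr hβ ha hφ hφΨ haΨ
    (Real.exp_pos _).le exp_neg_half_mul_one_add_le hay hay' haκ hκ)

lemma l1Distance_le_of_lt (hν : IsSubordinatorLevyMeasure ν)
    (hM : IsPoissonRandomMeasure M (jumpIntensity ν) P) {δ : ℝ} (hδ0 : 0 < δ) (hδ1 : δ ≤ 1)
    (h : 0 < ν (Set.Ici δ)) {ε : ℝ} (h0 : 0 < ε) (hε : ε < δ) :
    l1Distance P (expFunctional (pureJumpSubordinator M))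
        (expFunctional (latticeSubordinator M ε)) ≤
      ENNReal.ofReal (1 / ((1 - Real.exp (-(δ / 2))) * ν.real (Set.Ici δ)) ^ 2 *
        rateRho ν ε ^ 2) := by
  have h1 : ε < 1 := hε.trans_le hδ1
  have hp := hν.le_floorExponent_pos hδ0 h
  have hpφ := hν.le_floorExponent h0 hε.le
  obtain ⟨hs, hsr⟩ := hν.integral_small_jumps h1.le
  obtain ⟨hφΨ, hκ⟩ := hν.floorExponent_le h0 h1
  rw [l1Distance_eq hν hM h0 h1 (hp.trans_le hpφ), hν.rateRho_sq_eq_add h0 h1.le,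
    hν.integral_eq_add ε]
  refine ENNReal.ofReal_le_ofReal (one_div_sub_one_div_le' hs hsr hp hpφ hφΨ ?_)
  -- Since κ ≥ 1, the weighted bound κ(Ψ - φ) ≤ b implies Ψ - φ ≤ b.
  refine (le_mul_of_one_le_left (sub_nonneg.2 hφΨ) ?_).trans hκ
  nlinarith

end Comparison

theorem mainTheorem5 (ν : Measure ℝ) (hν : IsSubordinatorLevyMeasure ν) (hν0 : ν ≠ 0) :
    -- the constants, which depend on `ν` only
    (0 < ν (Set.Ici 1) →
      (0 < constOne ν ∧ constOne ν = 1 / latticeLaplaceExponent ν 1 1 ^ 2) ∧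
      (0 < constTwo ν ∧
        constTwo ν = Real.sqrt (2 * Real.pi) / latticeLaplaceExponent ν 1 2 ^ (3 / 2 : ℝ))) ∧
    ∃ C : ℝ → ℝ, (∀ δ, 0 < C δ) ∧
      ∀ (Ω : Type*) [MeasurableSpace Ω] (P : Measure Ω) [IsProbabilityMeasure P]
        (M : Ω → Measure (ℝ × ℝ)), IsPoissonRandomMeasure M (jumpIntensity ν) P →
        -- `I_{[X]}` is an integrable random variable, and each `I_{[X^{(ε)}]}` a random variable
        (AEMeasurable (expFunctional (pureJumpSubordinator M)) P ∧
          ∫⁻ ω, expFunctional (pureJumpSubordinator M) ω ∂P < ∞ ∧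
          ∀ ε : ℚ, 0 < ε → ε < 1 →
            AEMeasurable (expFunctional (latticeSubordinator M ε)) P) ∧
        -- convergence in `L¹` as `ε ↘ 0`
        Tendsto (fun ε : ℚ => l1Distance P (expFunctional (pureJumpSubordinator M))
            (expFunctional (latticeSubordinator M ε))) (𝓝[>] 0) (𝓝 0) ∧
        -- the bound with the explicit constants
        (0 < ν (Set.Ici 1) → ∀ ε : ℚ, 0 < ε → ε < 1 →
          l1Distance P (expFunctional (pureJumpSubordinator M))
              (expFunctional (latticeSubordinator M ε)) ≤
            ENNReal.ofReal ((constOne ν + constTwo ν) * rateRho ν ε ^ 2)) ∧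
        -- the bound with a finite constant for every `ν`
        (∀ δ : ℝ, 0 < δ → δ ≤ 1 → 0 < ν (Set.Ici δ) → ∀ ε : ℚ, 0 < ε → (ε : ℝ) < δ →
          l1Distance P (expFunctional (pureJumpSubordinator M))
              (expFunctional (latticeSubordinator M ε)) ≤
            ENNReal.ofReal (C δ * rateRho ν ε ^ 2)) := by
  have hconst : 0 < ν (Set.Ici 1) →
      (0 < constOne ν ∧ constOne ν = 1 / latticeLaplaceExponent ν 1 1 ^ 2) ∧
      (0 < constTwo ν ∧
        constTwo ν = Real.sqrt (2 * Real.pi) / latticeLaplaceExponent ν 1 2 ^ (3 / 2 : ℝ)) := by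
    intro h
    have h1 := hν.latticeLaplaceExponent_one_pos h one_pos
    have h2 := hν.latticeLaplaceExponent_one_pos h two_pos
    refine ⟨⟨?_, constOne_eq h1⟩, ?_, constTwo_eq h2⟩
    · rw [constOne_eq h1]; positivity
    · rw [constTwo_eq h2]; positivity
  -- The value 1 is a default that keeps C positive where `ν` has no mass on [δ, ∞) or δ ≤ 0.
  refine ⟨hconst, fun δ => if 0 < δ ∧ 0 < ν (Set.Ici δ) then
    1 / ((1 - Real.exp (-(δ / 2))) * ν.real (Set.Ici δ)) ^ 2 else 1, fun δ => ?_, ?_⟩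
  · dsimp only
    split_ifs with h
    · have := hν.le_floorExponent_pos h.1 h.2
      positivity
    · exact one_pos
  intro Ω _ P _ M hM
  obtain ⟨δ, hδ0, hδ1, hδ⟩ := hν.exists_measure_Ici_pos hν0
  refine ⟨⟨(measurable_expFunctional_pureJump hM).aemeasurable, ?_, fun ε _ _ =>
    (measurable_expFunctional_lattice hM ε).aemeasurable⟩, ?_, fun h ε h0 h1 => ?_,
    fun δ hδ0 hδ1 hδ ε h0 hε => ?_⟩
  -- Level δ/2 rather than `δ`, because positivity of the exponent of X is derived from a level
  -- strictly below 1 and δ = 1 is allowed.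
  · have hφ : 0 < floorExponent ν (δ / 2) := (hν.le_floorExponent_pos hδ0 hδ).trans_le
      (hν.le_floorExponent (half_pos hδ0) (by linarith))
    rw [lintegral_expFunctional_pureJump hν hM
      (integral_one_sub_exp_neg_pos hν (half_pos hδ0) (by linarith) hφ)]
    exact ENNReal.ofReal_lt_top
  · have hcast : Tendsto (fun ε : ℚ => (ε : ℝ)) (𝓝[>] 0) (𝓝[>] 0) := by
      refine tendsto_nhdsWithin_iff.2 ⟨?_, ?_⟩
      · exact (Rat.continuous_coe_real.tendsto' 0 0 Rat.cast_zero).mono_left nhdsWithin_le_nhds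
      · filter_upwards [self_mem_nhdsWithin] with ε hε
        exact Set.mem_Ioi.2 (Rat.cast_pos.2 hε)
    have hlim := (ENNReal.continuous_ofReal.tendsto _).comp
      (((hν.tendsto_rateRho_sq).comp hcast).const_mul
        (1 / ((1 - Real.exp (-(δ / 2))) * ν.real (Set.Ici δ)) ^ 2))
    rw [mul_zero, ENNReal.ofReal_zero] at hlim
    refine tendsto_of_tendsto_of_tendsto_of_le_of_le' tendsto_const_nhds hlim
      (.of_forall fun _ => zero_le) ?_
    filter_upwards [hcast (Ioo_mem_nhdsGT hδ0)] with ε hε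
    exact l1Distance_le_of_lt hν hM hδ0 hδ1 hδ hε.1 hε.2
  · refine (l1Distance_le_constOne hν hM h (Rat.cast_pos.2 h0) (by exact_mod_cast h1)).trans
      (ENNReal.ofReal_le_ofReal ?_)
    have := (hconst h).2.1
    gcongr
    linarith
  · simp only [if_pos (And.intro hδ0 hδ)]
    exact l1Distance_le_of_lt hν hM hδ0 hδ1 hδ (Rat.cast_pos.2 h0) hε
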